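/- **Theorem 3.13.** For $\beta\in\mathbb N$ and a norm $\|\cdot\|$ on $\mathbb R^d$, call $\beta$ a *Besicovitch constant* of $(\mathbb R^d,\|\cdot\|)$ if for every $A\subseteq\mathbb R^d$ and every $\delta>0$ there are $\beta$ countable families of closed balls of radius $\delta$ with centers in $A$, the balls within each family being pairwise disjoint, such that all these balls together cover $A$. For every $\beta\in\mathbb N$ there is a constant $C>0$, depending only on $\beta$, such that the following holds. Let $\|\cdot\|$ be any norm on $\mathbb R^d$ having $\beta$ as a Besicovitch constant. Let $\nu$ be a probability distribution on $\mathbb R^d$ with a density whose essential supremum $\sigma$ is finite, and let $X_1,X_2,\dots$ be independent random points with law $\nu$. Let $r=r(n)>0$ with $r(n)\to0$ and $$\frac{\sigma\,n\,r(n)^d}{\log n}\to t\in(0,\infty)\qquad(n\to\infty).$$ Let $q=q(n)\in[0,1]$ with $q(n)\le C$ for all $n$. Let $G_n^{0,q}$ be the random graph with vertices $X_1,\dots,X_n$ in which $X_i$ and $X_j$ ($i\ne j$) are always adjacent if $\|X_i-X_j\|\le r(n)$ and otherwise are adjacent with probability $q(n)$, independently for all such pairs. Then there is a constant $K>0$ (not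 depending on $n$) such that, with probability tending to $1$ as $n\to\infty$, every edge $(u,v)$ of $G_n^{0,q}$ with $\|u-v\|>3r(n)$ (a *long edge*) satisfies $$\omega_{u,v}(G_n^{0,q})\le K\,n\,r(n)^d,$$ where the *edge clique number* $\omega_{u,v}(G)$ is the largest size of a clique of $G$ containing both $u$ and $v$. -/

import Mathlib

open MeasureTheory ProbabilityTheory Filter Topology

namespace NoisyRGG

/-- `β` is a Besicovitch constant of `ℝ^d` with the norm `N`: for every set `A` and every `δ > 0`
there are `β` countable families of closed `δ`-balls with centers in `A` (family `i` is given by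
its set of centers `S i`), each family consisting of pairwise disjoint balls, such that all these
balls together cover `A`. -/
def IsBesicovitchConstant {d : ℕ} (N : Seminorm ℝ (Fin d → ℝ)) (β : ℕ) : Prop :=
  ∀ (A : Set (Fin d → ℝ)) (δ : ℝ), 0 < δ →
    ∃ S : Fin β → Set (Fin d → ℝ),
      (∀ i, S i ⊆ A ∧ (S i).Countable ∧ (S i).PairwiseDisjoint (fun c => N.closedBall c δ)) ∧
      A ⊆ ⋃ i, ⋃ c ∈ S i, N.closedBall c δ

/-- The covering lemma for balls of equal radius in a normed space. -/
theorem exists_ball_packings {E : Type*} [NormedAddCommGroup E] [NormedSpace ℝ E] [FiniteDimensional ℝ E] :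
    ∃ β : ℕ, ∀ (A : Set E) (δ : ℝ), 0 < δ → ∃ S : Fin β → Set E,
      (∀ i, S i ⊆ A ∧ (S i).Countable ∧ (S i).PairwiseDisjoint (fun c => Metric.closedBall c δ)) ∧
      A ⊆ ⋃ i, ⋃ c ∈ S i, Metric.closedBall c δ := by
  refine ⟨Besicovitch.multiplicity E, fun A δ hδ => ?_⟩
  let b : Besicovitch.BallPackage A E := ⟨Subtype.val, fun _ => δ, fun _ => hδ, δ, fun _ => le_rfl⟩
  obtain ⟨s, hs, hc⟩ := Besicovitch.exist_disjoint_covering_families (Besicovitch.one_lt_goodτ E)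
    (Besicovitch.isEmpty_satelliteConfig_multiplicity E) b
  have hd : ∀ i, (Subtype.val '' s i).PairwiseDisjoint (fun c : E => Metric.closedBall c δ) := by
    rintro i _ ⟨x, hx, rfl⟩ _ ⟨y, hy, rfl⟩ hxy
    exact hs i hx hy (fun h => hxy (congrArg _ h))
  refine ⟨fun i => Subtype.val '' s i, fun i => ⟨Subtype.coe_image_subset _ _, ?_, hd i⟩, ?_⟩
  · exact (hd i).countable_of_nonempty_interior fun c _ =>
      (Metric.nonempty_ball.2 hδ).mono Metric.ball_subset_interior_closedBall
  · intro x hx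
    have := hc ⟨⟨x, hx⟩, rfl⟩
    simp only [Set.mem_iUnion] at this ⊢
    obtain ⟨i, j, hj, h⟩ := this
    exact ⟨i, j, ⟨j, hj, rfl⟩, Metric.ball_subset_closedBall h⟩

/-- Every norm on `ℝ^d` has a Besicovitch constant. -/
theorem exists_isBesicovitchConstant {d : ℕ} (N : Seminorm ℝ (Fin d → ℝ))
    (hN : ∀ x, N x = 0 → x = 0) : ∃ β, IsBesicovitchConstant N β := by
  have key : ∀ (F : Type) [iA : AddCommGroup F] [iM : Module ℝ F] [FiniteDimensional ℝ F]
      (N : Seminorm ℝ F) (_ : ∀ x, N x = 0 → x = 0), ∃ β : ℕ, ∀ (A : Set F) (δ : ℝ), 0 < δ →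
      ∃ S : Fin β → Set F,
      (∀ i, S i ⊆ A ∧ (S i).Countable ∧ (S i).PairwiseDisjoint (fun c => N.closedBall c δ)) ∧
      A ⊆ ⋃ i, ⋃ c ∈ S i, N.closedBall c δ := by
    intro F iA iM _ N hN
    let n1 : NormedAddCommGroup F := AddGroupNorm.toNormedAddCommGroup
      { N with eq_zero_of_map_eq_zero' := hN }
    let n2 : NormedSpace ℝ F := { iM with norm_smul_le := fun a b => (map_smul_eq_mul N a b).le }
    obtain ⟨β, h⟩ := exists_ball_packings (E := F)
    have e : ∀ (c : F) (δ : ℝ), Metric.closedBall c δ = N.closedBall c δ := by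
      intro c δ
      ext x
      rw [mem_closedBall_iff_norm, Seminorm.mem_closedBall]
      rfl
    exact ⟨β, by simpa only [e] using h⟩
  exact key (Fin d → ℝ) N hN

/-- The maximum density: the essential supremum of the density `f` for Lebesgue measure. -/
noncomputable def maxDensity {d : ℕ} (f : (Fin d → ℝ) → ENNReal) : ENNReal :=
  essSup f volume

/-- The random geometric graph: distinct vertices `i`, `j` are adjacent iff `N (x i - x j) ≤ r`. -/
def geometricGraph {d : ℕ} (N : Seminorm ℝ (Fin d → ℝ)) {V : Type*} (x : V → Fin d → ℝ) (r : ℝ) :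
    SimpleGraph V where
  Adj i j := i ≠ j ∧ N (x i - x j) ≤ r
  symm := ⟨fun i j h => ⟨h.1.symm, by rw [map_sub_rev]; exact h.2⟩⟩
  loopless := ⟨fun _ h => h.1 rfl⟩

/-- The `(0,q)`-perturbation of a graph, as a function of the outcome `b` of the coin flips: no edge
is deleted, and a pair of distinct non-adjacent vertices is joined iff its coin shows `true`. -/
def insertEdges {V : Type*} (G : SimpleGraph V) (b : Sym2 V → Bool) : SimpleGraph V where
  Adj i j := G.Adj i j ∨ (i ≠ j ∧ ¬ G.Adj i j ∧ b s(i, j) = true)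
  symm := ⟨fun i j h => by
    rcases h with h | ⟨h₁, h₂, h₃⟩
    · exact Or.inl h.symm
    · exact Or.inr ⟨h₁.symm, fun h => h₂ h.symm, by rw [Sym2.eq_swap]; exact h₃⟩⟩
  loopless := ⟨fun i h => by
    rcases h with h | h
    · exact G.irrefl h
    · exact h.1 rfl⟩

/-- The probabilistic setting. The points `X 0, X 1, …` are independent with common law `ν`; for
each `n` the coins `ξ n e`, indexed by the unordered pairs `e` from `Fin n`, are independent, show
`true` with probability `q n`, and are independent of the first `n` points. -/
structure IsNoisySample {Ω : Type*} [MeasurableSpace Ω] (P : Measure Ω) {E : Type*}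
    [MeasurableSpace E] (ν : Measure E) (q : ℕ → ℝ) (X : ℕ → Ω → E)
    (ξ : (n : ℕ) → Sym2 (Fin n) → Ω → Bool) : Prop where
  measurable_point : ∀ i, Measurable (X i)
  law_point : ∀ i, P.map (X i) = ν
  indep_point : iIndepFun X P
  measurable_coin : ∀ n e, Measurable (ξ n e)
  prob_coin : ∀ n e, P {ω | ξ n e ω = true} = ENNReal.ofReal (q n)
  indep_coin : ∀ n, iIndepFun (ξ n) P
  indep_point_coin : ∀ n,
    IndepFun (fun ω (i : Fin n) => X i ω) (fun ω (e : Sym2 (Fin n)) => ξ n e ω) P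

/-- The graph `G_n^{0,q}` on the first `n` points, at the sample point `ω`. -/
def noisyGraph {d : ℕ} (N : Seminorm ℝ (Fin d → ℝ)) (r : ℕ → ℝ) {Ω : Type*}
    (X : ℕ → Ω → Fin d → ℝ) (ξ : (n : ℕ) → Sym2 (Fin n) → Ω → Bool) (n : ℕ) (ω : Ω) :
    SimpleGraph (Fin n) :=
  insertEdges (geometricGraph N (fun i : Fin n => X i ω) (r n)) (fun e => ξ n e ω)

/-- The pair `(u, v)` is a long edge of the graph `G` whose vertex `i` sits at the point `x i`. -/
def IsLongEdge {d : ℕ} (N : Seminorm ℝ (Fin d → ℝ)) {V : Type*} (G : SimpleGraph V)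
    (x : V → Fin d → ℝ) (r : ℝ) (u v : V) : Prop :=
  G.Adj u v ∧ 3 * r < N (x u - x v)

/-- The edge clique number: the largest size of a clique of `G` that contains `u` and `v`. -/
noncomputable def edgeCliqueNumber {V : Type*} (G : SimpleGraph V) (u v : V) : ℕ :=
  sSup {k | ∃ s : Finset V, G.IsClique (s : Set V) ∧ u ∈ s ∧ v ∈ s ∧ s.card = k}

end NoisyRGG

namespace NoisyRGG

/-! ### Norm balls in `ℝ^d` -/

/-! The argument bounds every clique of the noisy graph, with `C = 1/2`. In this regime a ball of
radius `r n` has mass at most `p` with `n * p = O(log n)`, so for a large multiple `k` of `log n` a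
union bound over a vertex and `k` neighbours shows that all geometric degrees are below `k`, up to
small probability (`prob_not_degreeLT_le`).

If all degrees are below `k`, any `2k` vertices span at least `k²` geometrically non-adjacent pairs
(`exists_pairs_of_isClique_insertEdges`), and a clique on them needs all those coins to succeed.
Given the geometric graph this has probability at most `2^(-k²)`, which beats the at most `n^(2k)`
choices of vertices (`prob_degreeLT_and_isClique_le`). Hence cliques have size `O(log n)`, and `log
n` is of order `n * r n ^ d`. -/

theorem continuous_seminorm {d : ℕ} (N : Seminorm ℝ (Fin d → ℝ)) : Continuous N :=
  continuousOn_univ.1 (N.convexOn.continuousOn isOpen_univ)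

/-- By compactness `N` is bounded away from zero on the unit sphere. This gives norm balls finite
volume. -/
theorem exists_pos_mul_norm_le {d : ℕ} (N : Seminorm ℝ (Fin d → ℝ))
    (hN : ∀ x, N x = 0 → x = 0) : ∃ a : ℝ, 0 < a ∧ ∀ x, a * ‖x‖ ≤ N x := by
  obtain ⟨a, ha, h⟩ := (isCompact_sphere (0 : Fin d → ℝ) 1).exists_forall_le'
    (f := N) (a := 0) (continuous_seminorm N).continuousOn (fun x hx => by
      refine lt_of_le_of_ne (apply_nonneg N x) fun h0 => ?_
      have hx1 : ‖x‖ = 1 := by simpa using hx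
      rw [hN x h0.symm, norm_zero] at hx1
      exact zero_ne_one hx1)
  refine ⟨a, ha, fun x => ?_⟩
  rcases eq_or_ne x 0 with rfl | hx
  · simp
  · have hx' : 0 < ‖x‖ := norm_pos_iff.2 hx
    have := h (‖x‖⁻¹ • x) (by simp [norm_smul, hx'.ne'])
    rw [map_smul_eq_mul, norm_inv, norm_norm, ← div_eq_inv_mul, le_div_iff₀ hx'] at this
    exact this

theorem volume_closedBall_one_ne_top {d : ℕ} (N : Seminorm ℝ (Fin d → ℝ))
    (hN : ∀ x, N x = 0 → x = 0) : volume (N.closedBall 0 1) ≠ ⊤ := by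
  obtain ⟨a, ha, h⟩ := exists_pos_mul_norm_le N hN
  refine ne_top_of_le_ne_top (measure_closedBall_lt_top (x := (0 : Fin d → ℝ)) (r := a⁻¹)).ne
    (measure_mono fun x hx => ?_)
  rw [Seminorm.mem_closedBall, sub_zero] at hx
  rw [mem_closedBall_zero_iff, ← one_div, le_div_iff₀' ha]
  exact (h x).trans hx

open scoped Pointwise in
theorem volume_closedBall {d : ℕ} (N : Seminorm ℝ (Fin d → ℝ)) (x : Fin d → ℝ) {r : ℝ}
    (hr : 0 < r) :
    volume (N.closedBall x r) = ENNReal.ofReal (r ^ d) * volume (N.closedBall 0 1) := by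
  have h1 : N.closedBall x r = (fun y => y + -x) ⁻¹' (r • N.closedBall 0 1) := by
    rw [Seminorm.smul_closedBall_zero (by simpa using hr.ne')]
    ext y
    simp [Seminorm.mem_closedBall, abs_of_pos hr, sub_eq_add_neg]
  rw [h1, measure_preimage_add_right, Measure.addHaar_smul, abs_of_nonneg (by positivity)]
  simp

theorem withDensity_closedBall_le {d : ℕ} (N : Seminorm ℝ (Fin d → ℝ))
    (f : (Fin d → ℝ) → ENNReal) (x : Fin d → ℝ) {r : ℝ} (hr : 0 < r) :
    (volume.withDensity f) {y | N (x - y) ≤ r} ≤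
      maxDensity f * (ENNReal.ofReal (r ^ d) * volume (N.closedBall 0 1)) := by
  have hs : {y | N (x - y) ≤ r} = N.closedBall x r := by
    ext y
    rw [Seminorm.mem_closedBall, map_sub_rev]
    rfl
  have hm : MeasurableSet (N.closedBall x r) := by
    rw [← hs]
    exact (isClosed_le ((continuous_seminorm N).comp (by fun_prop)) continuous_const).measurableSet
  rw [hs, withDensity_apply _ hm, ← volume_closedBall N x hr]
  calc ∫⁻ y in N.closedBall x r, f y ≤ ∫⁻ _ in N.closedBall x r, maxDensity f :=
        setLIntegral_mono_ae aemeasurable_const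
          ((ae_le_essSup (f := f)).mono fun y hy _ => hy)
    _ = _ := by rw [setLIntegral_const]

/-! ### Probability bounds by conditioning -/

section Prob

variable {Ω : Type*} [MeasurableSpace Ω] {P : Measure Ω} [IsProbabilityMeasure P]

/-- Fubini: independence makes the joint law a product, so a bound uniform over frozen values of `Y`
survives averaging. -/
theorem prob_le_of_indepFun {α γ : Type*} [MeasurableSpace α] [MeasurableSpace γ]
    {Y : Ω → α} {Z : Ω → γ} (hY : Measurable Y) (hZ : Measurable Z) (h : IndepFun Y Z P)
    {T : Set (α × γ)} (hT : MeasurableSet T) {c : ENNReal}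
    (hc : ∀ y, P {ω | (y, Z ω) ∈ T} ≤ c) : P {ω | (Y ω, Z ω) ∈ T} ≤ c := by
  have hYp := Measure.isProbabilityMeasure_map hY.aemeasurable (μ := P)
  have hZp := Measure.isProbabilityMeasure_map hZ.aemeasurable (μ := P)
  have h1 : P {ω | (Y ω, Z ω) ∈ T} = (P.map fun ω => (Y ω, Z ω)) T :=
    (Measure.map_apply (hY.prodMk hZ) hT).symm
  rw [h1, (indepFun_iff_map_prod_eq_prod_map_map hY.aemeasurable hZ.aemeasurable).1 h,
    Measure.prod_apply hT]
  calc ∫⁻ y, (P.map Z) (Prod.mk y ⁻¹' T) ∂(P.map Y) ≤ ∫⁻ _, c ∂(P.map Y) := by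
        refine lintegral_mono fun y => ?_
        rw [Measure.map_apply hZ (measurable_prodMk_left hT)]
        exact hc y
    _ = c := by simp

/-- The events for different `j` share `X i`; once `X i` is frozen they are independent, each of
probability at most `p`. -/
theorem prob_forall_mem_le_pow {ι E : Type*} [MeasurableSpace E] {ν : Measure E}
    {X : ι → Ω → E} (hX : ∀ i, Measurable (X i)) (hν : ∀ i, P.map (X i) = ν)
    (hind : iIndepFun X P) {R : Set (E × E)} (hR : MeasurableSet R) {p : ENNReal}
    (hp : ∀ x, ν {y | (x, y) ∈ R} ≤ p) {i : ι} {J : Finset ι} (hi : i ∉ J) :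
    P {ω | ∀ j ∈ J, (X i ω, X j ω) ∈ R} ≤ p ^ J.card := by
  have hi' : Disjoint ({i} : Finset ι) J := Finset.disjoint_singleton_left.2 hi
  have heval : Measurable fun y : ({i} : Finset ι) → E => y ⟨i, Finset.mem_singleton_self i⟩ :=
    measurable_pi_apply _
  have h := (hind.indepFun_finset {i} J hi' hX).comp heval measurable_id
  have hT : MeasurableSet {z : E × (J → E) | ∀ j, (z.1, z.2 j) ∈ R} := by
    rw [Set.ofPred_forall]
    exact MeasurableSet.iInter fun j =>
      (measurable_fst.prodMk ((measurable_pi_apply j).comp measurable_snd)) hR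
  have key := prob_le_of_indepFun (P := P) (Y := X i) (Z := fun ω (j : J) => X j ω)
    (c := p ^ J.card) (hX i) (measurable_pi_lambda _ fun j => hX j) h hT (fun x => by
      have hRx : MeasurableSet {y | (x, y) ∈ R} := measurable_prodMk_left hR
      have : {ω | (x, fun j : J => X j ω) ∈ {z : E × (J → E) | ∀ j, (z.1, z.2 j) ∈ R}} =
          ⋂ j ∈ J, X j ⁻¹' {y | (x, y) ∈ R} := by
        ext ω
        simp
      rw [this, hind.measure_inter_preimage_eq_mul J fun _ _ => hRx, ← Finset.prod_const]
      refine Finset.prod_le_prod' fun j _ => ?_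
      rw [← Measure.map_apply (hX j) hRx, hν]
      exact hp x)
  refine le_trans (measure_mono fun ω hω => ?_) key
  exact fun j => hω j j.2

end Prob

theorem prob_forall_coin_le {Ω : Type*} [MeasurableSpace Ω] {P : Measure Ω} {ι : Type*}
    {ξ : ι → Ω → Bool} (hind : iIndepFun ξ P) {c : ENNReal}
    (hc : ∀ e, P {ω | ξ e ω = true} ≤ c) (F : Finset ι) :
    P {ω | ∀ e ∈ F, ξ e ω = true} ≤ c ^ F.card := by
  have : {ω | ∀ e ∈ F, ξ e ω = true} = ⋂ e ∈ F, ξ e ⁻¹' {true} := by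
    ext ω
    simp
  rw [this, hind.measure_inter_preimage_eq_mul F fun _ _ => measurableSet_singleton _,
    ← Finset.prod_const]
  exact Finset.prod_le_prod' fun e _ => hc e

/-! ### Cliques of a perturbed graph of small degree -/

/-- All vertices of `G` have fewer than `k` neighbours. -/
def DegreeLT {V : Type*} (G : SimpleGraph V) (k : ℕ) : Prop :=
  ∀ (i : V) (J : Finset V), (∀ j ∈ J, G.Adj i j) → J.card < k

/-- `F` is chosen before the coins `b`, so independence of the coins applies to it. -/
theorem exists_pairs_of_isClique_insertEdges {V : Type*} [Fintype V] (G : SimpleGraph V) {k : ℕ}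
    (hG : DegreeLT G k) {S : Finset V}
    (hS : S.card = 2 * k) :
    ∃ F : Finset (Sym2 V), k * k ≤ F.card ∧
      ∀ b, (insertEdges G b).IsClique (S : Set V) → ∀ e ∈ F, b e = true := by
  classical
  let H : SimpleGraph V :=
    { Adj := fun i j => i ∈ S ∧ j ∈ S ∧ i ≠ j ∧ ¬ G.Adj i j
      symm := ⟨fun i j h => ⟨h.2.1, h.1, h.2.2.1.symm, fun h' => h.2.2.2 h'.symm⟩⟩
      loopless := ⟨fun i h => h.2.2.1 rfl⟩ }
  refine ⟨H.edgeFinset, ?_, ?_⟩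
  -- Of the `2k - 1` other vertices of `S`, at most `k - 1` are neighbours in `G`. Summing over `S`
  -- counts each edge of `H` twice.
  · have hdeg : ∀ i ∈ S, k ≤ H.degree i := by
      intro i hi
      have h1 : S.erase i ⊆ H.neighborFinset i ∪ S.filter (G.Adj i) := by
        intro j hj
        rw [Finset.mem_erase] at hj
        by_cases hij : G.Adj i j
        · exact Finset.mem_union_right _ (Finset.mem_filter.2 ⟨hj.2, hij⟩)
        · refine Finset.mem_union_left _ ?_
          rw [SimpleGraph.mem_neighborFinset]
          exact ⟨hi, hj.2, hj.1.symm, hij⟩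
      have h2 := (Finset.card_le_card h1).trans (Finset.card_union_le _ _)
      have h3 := hG i (S.filter (G.Adj i)) fun j hj => (Finset.mem_filter.1 hj).2
      rw [Finset.card_erase_of_mem hi, SimpleGraph.card_neighborFinset_eq_degree] at h2
      omega
    have h1 : S.card * k ≤ ∑ v, H.degree v := by
      rw [← smul_eq_mul]
      exact (Finset.card_nsmul_le_sum S _ _ hdeg).trans
        (Finset.sum_le_sum_of_subset (Finset.subset_univ S))
    rw [H.sum_degrees_eq_twice_card_edges, hS, mul_assoc] at h1
    omega
  · intro b hb e he
    induction e with
    | _ i j =>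
      rw [SimpleGraph.mem_edgeFinset, SimpleGraph.mem_edgeSet] at he
      rcases hb he.1 he.2.1 he.2.2.1 with h | h
      · exact absurd h he.2.2.2
      · exact h.2.2

theorem edgeCliqueNumber_le {V : Type*} (G : SimpleGraph V) (u v : V) {s : ℕ}
    (h : ∀ S : Finset V, S.card = s → ¬ G.IsClique (S : Set V)) : edgeCliqueNumber G u v ≤ s := by
  -- In `ℕ` an upper bound suffices: if no clique contains `u` and `v`, the supremum is `0`.
  refine csSup_le' ?_
  rintro _ ⟨T, hT, -, -, rfl⟩
  by_contra! hlt
  obtain ⟨S, hST, hS⟩ := Finset.exists_subset_card_eq hlt.le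
  exact h S hS (hT.subset (by exact_mod_cast hST))

/-! ### The clique number of the noisy random geometric graph -/

section Clique

variable {Ω : Type*} [MeasurableSpace Ω] {P : Measure Ω} [IsProbabilityMeasure P] {d : ℕ}
  {ν : Measure (Fin d → ℝ)} {q : ℕ → ℝ} {X : ℕ → Ω → Fin d → ℝ}
  {ξ : (n : ℕ) → Sym2 (Fin n) → Ω → Bool}

theorem prob_not_degreeLT_le (N : Seminorm ℝ (Fin d → ℝ)) (h : IsNoisySample P ν q X ξ)
    {r : ℝ} {p : ENNReal} (hp : ∀ x, ν {y | N (x - y) ≤ r} ≤ p) (n k : ℕ) :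
    P {ω | ¬ DegreeLT (geometricGraph N (fun i : Fin n => X i ω) r) k} ≤
      n * (n.choose k * p ^ k) := by
  have hR : MeasurableSet {z : (Fin d → ℝ) × (Fin d → ℝ) | N (z.1 - z.2) ≤ r} :=
    (isClosed_le ((continuous_seminorm N).comp (by fun_prop)) continuous_const).measurableSet
  have hsub : {ω | ¬ DegreeLT (geometricGraph N (fun i : Fin n => X i ω) r) k} ⊆
      ⋃ i ∈ (Finset.univ : Finset (Fin n)),
        ⋃ J ∈ (Finset.powersetCard k (Finset.univ : Finset (Fin n))),
          {ω | i ∉ J ∧ ∀ j ∈ J, N (X i ω - X j ω) ≤ r} := by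
    intro ω hω
    simp only [DegreeLT, Set.mem_ofPred_eq, not_forall, not_lt] at hω
    obtain ⟨i, J, hJ, hk⟩ := hω
    obtain ⟨J', hJ', hc⟩ := Finset.exists_subset_card_eq hk
    simp only [Set.mem_iUnion, Finset.mem_powersetCard]
    exact ⟨i, Finset.mem_univ _, J', ⟨Finset.subset_univ _, hc⟩,
      fun hi => (hJ i (hJ' hi)).1 rfl, fun j hj => (hJ j (hJ' hj)).2⟩
  have hone : ∀ (i : Fin n), ∀ J ∈ Finset.powersetCard k (Finset.univ : Finset (Fin n)),
      P {ω | i ∉ J ∧ ∀ j ∈ J, N (X i ω - X j ω) ≤ r} ≤ p ^ k := by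
    intro i J hJ
    by_cases hi : i ∈ J
    · simp [hi]
    · rw [← (Finset.mem_powersetCard.1 hJ).2]
      refine le_trans (measure_mono fun ω hω => hω.2) (prob_forall_mem_le_pow
        (X := fun i : Fin n => X i) (fun i => h.measurable_point i) (fun i => h.law_point i)
        (h.indep_point.precomp Fin.val_injective) hR hp hi)
  calc _ ≤ _ := measure_mono hsub
    _ ≤ _ := measure_biUnion_finset_le _ _
    _ ≤ ∑ _i : Fin n, ∑ _J ∈ Finset.powersetCard k (Finset.univ : Finset (Fin n)), p ^ k :=
        Finset.sum_le_sum fun i _ =>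
          (measure_biUnion_finset_le _ _).trans (Finset.sum_le_sum (hone i))
    _ = _ := by simp

theorem prob_degreeLT_and_isClique_le (N : Seminorm ℝ (Fin d → ℝ))
    (h : IsNoisySample P ν q X ξ) (r : ℕ → ℝ) (n k : ℕ) (hq : q n ≤ 1 / 2) :
    P {ω | DegreeLT (geometricGraph N (fun i : Fin n => X i ω) (r n)) k ∧
      ∃ S : Finset (Fin n), S.card = 2 * k ∧
        (noisyGraph N r X ξ n ω).IsClique (S : Set (Fin n))} ≤
      n.choose (2 * k) * (ENNReal.ofReal (1 / 2)) ^ (k * k) := by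
  -- Conditioning is on the geometric graph rather than on the points: it takes finitely many
  -- values, so the event below is trivially measurable.
  let _ : MeasurableSpace (SimpleGraph (Fin n)) := ⊤
  have hg : Measurable fun x : Fin n → Fin d → ℝ => geometricGraph N x (r n) := by
    refine measurable_to_countable' fun H => ?_
    have : (fun x : Fin n → Fin d → ℝ => geometricGraph N x (r n)) ⁻¹' {H} =
        {x | ∀ i j, (i ≠ j ∧ N (x i - x j) ≤ r n) ↔ H.Adj i j} := by
      ext x
      rw [Set.mem_preimage, Set.mem_singleton_iff, SimpleGraph.ext_iff, funext_iff]
      simp only [funext_iff, eq_iff_iff]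
      rfl
    rw [this]
    simp only [Set.ofPred_forall]
    refine MeasurableSet.iInter fun i => MeasurableSet.iInter fun j => ?_
    have hc : MeasurableSet {x : Fin n → Fin d → ℝ | N (x i - x j) ≤ r n} :=
      (isClosed_le ((continuous_seminorm N).comp (by fun_prop)) continuous_const).measurableSet
    exact ((MeasurableSet.const _).inter hc).iff (MeasurableSet.const _)
  have hX : Measurable fun ω (i : Fin n) => X i ω :=
    measurable_pi_lambda _ fun i => h.measurable_point i
  have hξ : Measurable fun ω (e : Sym2 (Fin n)) => ξ n e ω :=
    measurable_pi_lambda _ fun e => h.measurable_coin n e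
  have hind := (h.indep_point_coin n).comp hg measurable_id
  refine prob_le_of_indepFun (hg.comp hX) hξ hind
    (T := {z | DegreeLT z.1 k ∧ ∃ S : Finset (Fin n), S.card = 2 * k ∧
      (insertEdges z.1 z.2).IsClique (S : Set (Fin n))}) (Set.toFinite _).measurableSet
    fun G => ?_
  by_cases hG : DegreeLT G k
  swap
  · simp [hG]
  have hsub : {ω | (G, fun e => ξ n e ω) ∈ {z : SimpleGraph (Fin n) × (Sym2 (Fin n) → Bool) |
        DegreeLT z.1 k ∧ ∃ S : Finset (Fin n), S.card = 2 * k ∧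
          (insertEdges z.1 z.2).IsClique (S : Set (Fin n))}} ⊆
      ⋃ S ∈ Finset.powersetCard (2 * k) (Finset.univ : Finset (Fin n)),
        {ω | (insertEdges G fun e => ξ n e ω).IsClique (S : Set (Fin n))} := by
    rintro ω ⟨-, S, hS, hc⟩
    simp only [Set.mem_iUnion, Finset.mem_powersetCard]
    exact ⟨S, ⟨Finset.subset_univ _, hS⟩, hc⟩
  calc _ ≤ _ := measure_mono hsub
    _ ≤ _ := measure_biUnion_finset_le _ _
    _ ≤ ∑ _S ∈ Finset.powersetCard (2 * k) (Finset.univ : Finset (Fin n)),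
          ENNReal.ofReal (1 / 2) ^ (k * k) := Finset.sum_le_sum fun S hS => by
        obtain ⟨F, hF, hb⟩ :=
          exists_pairs_of_isClique_insertEdges G hG (Finset.mem_powersetCard.1 hS).2
        calc _ ≤ P {ω | ∀ e ∈ F, ξ n e ω = true} := measure_mono fun ω hω => hb _ hω
          _ ≤ ENNReal.ofReal (1 / 2) ^ F.card := prob_forall_coin_le (h.indep_coin n)
              (fun e => (h.prob_coin n e).trans_le (ENNReal.ofReal_le_ofReal hq)) F
          _ ≤ _ := pow_le_pow_right_of_le_one' (by simp) hF
    _ = _ := by simp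

theorem prob_exists_isClique_le (N : Seminorm ℝ (Fin d → ℝ)) (h : IsNoisySample P ν q X ξ)
    (r : ℕ → ℝ) {p : ℝ} (hp0 : 0 ≤ p) (n k : ℕ)
    (hp : ∀ x, ν {y | N (x - y) ≤ r n} ≤ ENNReal.ofReal p) (hq : q n ≤ 1 / 2) :
    P {ω | ∃ S : Finset (Fin n), S.card = 2 * k ∧
        (noisyGraph N r X ξ n ω).IsClique (S : Set (Fin n))} ≤
      ENNReal.ofReal (n * (n.choose k * p ^ k) + n.choose (2 * k) * (1 / 2) ^ (k * k)) := by
  rw [ENNReal.ofReal_add (by positivity) (by positivity), ENNReal.ofReal_mul (by positivity),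
    ENNReal.ofReal_mul (by positivity), ENNReal.ofReal_mul (by positivity),
    ENNReal.ofReal_pow hp0, ENNReal.ofReal_pow (by norm_num)]
  simp only [ENNReal.ofReal_natCast]
  refine le_trans (measure_mono fun ω hω => ?_) ((measure_union_le _ _).trans
    (add_le_add (prob_not_degreeLT_le N h hp n k) (prob_degreeLT_and_isClique_le N h r n k hq)))
  by_cases hd : DegreeLT (geometricGraph N (fun i : Fin n => X i ω) (r n)) k
  · exact Or.inr ⟨hd, hω⟩
  · exact Or.inl hd

end Clique

/-! ### Numerical estimates -/

/-- After multiplication by `e^k`, the bound `(np)^k / k!` becomes one term of the series of `exp (e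
* n * p)`. -/
theorem choose_mul_pow_le_exp (n k : ℕ) {p : ℝ} (hp : 0 ≤ p) :
    n.choose k * p ^ k ≤ Real.exp (Real.exp 1 * (n * p) - k) := by
  have h1 : (n.choose k : ℝ) ≤ (n : ℝ) ^ k / k.factorial := Nat.choose_le_pow_div k n
  have h2 := Real.pow_div_factorial_le_exp (Real.exp 1 * (n * p)) (by positivity) k
  rw [Real.exp_sub, le_div_iff₀ (Real.exp_pos _)]
  refine le_trans ?_ h2
  have h3 : Real.exp k = Real.exp 1 ^ k := by rw [← Real.exp_nat_mul, mul_one]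
  calc (n.choose k : ℝ) * p ^ k * Real.exp k
      ≤ (n : ℝ) ^ k / k.factorial * p ^ k * Real.exp k := by gcongr
    _ = _ := by rw [h3, mul_pow, mul_pow]; ring

theorem choose_two_mul_mul_half_pow_le {n k : ℕ} (hn : 0 < n) (hk : 6 * Real.log n ≤ k) :
    n.choose (2 * k) * (1 / 2 : ℝ) ^ (k * k) ≤ Real.exp (-(2 * Real.log n * k)) := by
  have hn' : (0 : ℝ) < n := by exact_mod_cast hn
  have h1 : (n.choose (2 * k) : ℝ) ≤ (n : ℝ) ^ (2 * k) := by exact_mod_cast Nat.choose_le_pow n _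
  have h2 : (n : ℝ) ^ (2 * k) = Real.exp (2 * k * Real.log n) := by
    rw [← Real.exp_log hn', ← Real.exp_nat_mul, Real.exp_log hn']
    push_cast
    rfl
  have h3 : (1 / 2 : ℝ) ^ (k * k) = Real.exp (-(k * k * Real.log 2)) := by
    rw [Real.exp_neg, one_div, inv_pow, ← Real.exp_log (two_pos (α := ℝ)), ← Real.exp_nat_mul,
      Real.exp_log (two_pos (α := ℝ))]
    push_cast
    rfl
  -- Here `6 * log 2 > 4`: half of the resulting exponent `4 * k * log n` pays for the factor
  -- `n^(2k)`.
  have h4 : 4 * Real.log n ≤ k * Real.log 2 := by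
    have := Real.log_two_gt_d9
    have := Real.log_natCast_nonneg n
    nlinarith
  calc _ ≤ (n : ℝ) ^ (2 * k) * (1 / 2 : ℝ) ^ (k * k) := by gcongr
    _ = Real.exp (2 * k * Real.log n + -(k * k * Real.log 2)) := by rw [h2, h3, Real.exp_add]
    _ ≤ _ := by
      refine Real.exp_le_exp.2 ?_
      have := mul_le_mul_of_nonneg_left h4 (Nat.cast_nonneg (α := ℝ) k)
      linarith

theorem clique_bound_le_two_div {n k : ℕ} {p B : ℝ} (hp : 0 ≤ p) (hn : 1 ≤ Real.log n)
    (hB : 0 ≤ B) (hnp : n * p ≤ B * Real.log n) (hk : (6 + Real.exp 1 * B) * Real.log n ≤ k) :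
    n * (n.choose k * p ^ k) + n.choose (2 * k) * (1 / 2 : ℝ) ^ (k * k) ≤ 2 / n := by
  have hn0 : 0 < n := by
    rcases Nat.eq_zero_or_pos n with rfl | h
    · norm_num at hn
    · exact h
  have hn' : (0 : ℝ) < n := by exact_mod_cast hn0
  have he : 0 ≤ Real.exp 1 * B * Real.log n := by positivity
  have hinv : Real.exp (-Real.log n) = 1 / n := by rw [Real.exp_neg, Real.exp_log hn', one_div]
  have h1 : (n : ℝ) * (n.choose k * p ^ k) ≤ 1 / n := by
    calc (n : ℝ) * (n.choose k * p ^ k)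
        ≤ Real.exp (Real.log n) * Real.exp (Real.exp 1 * (n * p) - k) := by
          rw [Real.exp_log hn']
          gcongr
          exact choose_mul_pow_le_exp n k hp
      _ ≤ Real.exp (-Real.log n) := by
          rw [← Real.exp_add, Real.exp_le_exp]
          have := mul_le_mul_of_nonneg_left hnp (Real.exp_pos 1).le
          nlinarith
      _ = 1 / n := hinv
  have h2 : n.choose (2 * k) * (1 / 2 : ℝ) ^ (k * k) ≤ 1 / n := by
    refine (choose_two_mul_mul_half_pow_le hn0 (by nlinarith)).trans ?_
    rw [← hinv, Real.exp_le_exp]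
    have hk1 : (1 : ℝ) ≤ k := by nlinarith
    nlinarith
  calc _ ≤ 1 / (n : ℝ) + 1 / n := add_le_add h1 h2
    _ = 2 / n := by ring

theorem tendsto_prob_one_of_compl_subset {Ω : Type*} [MeasurableSpace Ω] {P : Measure Ω}
    [IsProbabilityMeasure P] {A B : ℕ → Set Ω} {a : ℕ → ℝ} (ha : Tendsto a atTop (𝓝 0))
    (hAB : ∀ᶠ n in atTop, (A n)ᶜ ⊆ B n) (hB : ∀ᶠ n in atTop, P (B n) ≤ ENNReal.ofReal (a n)) :
    Tendsto (fun n => P (A n)) atTop (𝓝 1) := by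
  have h1 : Tendsto (fun n => 1 - ENNReal.ofReal (a n)) atTop (𝓝 1) := by
    have := ENNReal.Tendsto.sub (tendsto_const_nhds (x := (1 : ENNReal)) (f := atTop))
      (ENNReal.tendsto_ofReal ha) (Or.inl ENNReal.one_ne_top)
    simpa using this
  refine tendsto_of_tendsto_of_tendsto_of_le_of_le' h1 tendsto_const_nhds ?_
    (Eventually.of_forall fun n => prob_le_one)
  filter_upwards [hAB, hB] with n h2 h3
  rw [tsub_le_iff_right]
  -- Subadditivity needs no measurability of `A n`.
  calc (1 : ENNReal) = P (A n ∪ (A n)ᶜ) := by rw [Set.union_compl_self, measure_univ]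
    _ ≤ P (A n) + P (A n)ᶜ := measure_union_le _ _
    _ ≤ _ := by
      gcongr
      exact (measure_mono h2).trans h3

end NoisyRGG

/-! ### Choice of constants in the logarithmic regime -/

theorem theorem3p13 (β : ℕ) :
    ∃ C : ℝ, 0 < C ∧
      ∀ (d : ℕ) (N : Seminorm ℝ (Fin d → ℝ)) (_ : ∀ x, N x = 0 → x = 0)
        (_ : NoisyRGG.IsBesicovitchConstant N β)
        (f : (Fin d → ℝ) → ENNReal) (_ : Measurable f) (_ : ∫⁻ x, f x = 1)
        (_ : NoisyRGG.maxDensity f ≠ ⊤)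
        (r : ℕ → ℝ) (_ : ∀ n, 0 < r n) (_ : Tendsto r atTop (𝓝 0))
        (t : ℝ) (_ : 0 < t)
        (_ : Tendsto (fun n : ℕ => (NoisyRGG.maxDensity f).toReal * n * r n ^ d / Real.log n)
          atTop (𝓝 t))
        (q : ℕ → ℝ) (_ : ∀ n, 0 ≤ q n ∧ q n ≤ 1) (_ : ∀ n, q n ≤ C)
        (Ω : Type*) [MeasurableSpace Ω] (P : Measure Ω) [IsProbabilityMeasure P]
        (X : ℕ → Ω → Fin d → ℝ) (ξ : (n : ℕ) → Sym2 (Fin n) → Ω → Bool)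
        (_ : NoisyRGG.IsNoisySample P (volume.withDensity f) q X ξ),
        ∃ K : ℝ, 0 < K ∧
          Tendsto (fun n : ℕ => P {ω | ∀ u v : Fin n,
              NoisyRGG.IsLongEdge N (NoisyRGG.noisyGraph N r X ξ n ω)
                (fun i : Fin n => X i ω) (r n) u v →
              (NoisyRGG.edgeCliqueNumber (NoisyRGG.noisyGraph N r X ξ n ω) u v : ℝ)
                ≤ K * (n * r n ^ d)})
            atTop (𝓝 1) := by
  refine ⟨1 / 2, by norm_num, ?_⟩
  intro d N hN _ f _ _ hσ r hr _ t ht hlim q _ hqC Ω _ P _ X ξ hS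
  set σ : ℝ := (NoisyRGG.maxDensity f).toReal with hσdef
  set c : ℝ := (volume (N.closedBall 0 1)).toReal with hcdef
  have hσ0 : 0 ≤ σ := ENNReal.toReal_nonneg
  have hc0 : 0 ≤ c := ENNReal.toReal_nonneg
  set B : ℝ := 2 * t * c with hBdef
  have hB : 0 ≤ B := by positivity
  -- The term `e * B` absorbs `e * n * p`; the `6` covers the union bound over vertices and the
  -- count of `2k`-sets.
  set D : ℝ := 6 + Real.exp 1 * B with hDdef
  have hD : 0 ≤ D := by positivity
  have hlog : Tendsto (fun n : ℕ => Real.log n) atTop atTop :=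
    Real.tendsto_log_atTop.comp tendsto_natCast_atTop_atTop
  have hlog1 : ∀ᶠ n : ℕ in atTop, 1 ≤ Real.log n := hlog.eventually_ge_atTop 1
  have hup := hlim.eventually_le_const (show t < 2 * t by linarith)
  have hlow := hlim.eventually_const_le (show t / 2 < t by linarith)
  -- The `+ 2` absorbs the rounding in `⌈D * log n⌉₊` once `log n ≥ 1`; the `+ 1` gives positivity
  -- from `0 ≤ σ` alone.
  refine ⟨(2 * D + 2) * (2 * σ / t) + 1, by positivity, ?_⟩
  refine NoisyRGG.tendsto_prob_one_of_compl_subset (a := fun n : ℕ => 2 / (n : ℝ))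
    (B := fun n => {ω | ∃ S : Finset (Fin n), S.card = 2 * ⌈D * Real.log n⌉₊ ∧
        (NoisyRGG.noisyGraph N r X ξ n ω).IsClique (S : Set (Fin n))})
    (tendsto_const_div_atTop_nhds_zero_nat 2) ?_ ?_
  · filter_upwards [hlog1, hlow] with n hn hl ω hω
    by_contra hcl
    refine hω fun u v _ => ?_
    have h1 : NoisyRGG.edgeCliqueNumber (NoisyRGG.noisyGraph N r X ξ n ω) u v ≤
        2 * ⌈D * Real.log n⌉₊ :=
      NoisyRGG.edgeCliqueNumber_le _ u v fun S hS h => hcl ⟨S, hS, h⟩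
    have hL : 0 < Real.log n := by linarith
    have h2 : (⌈D * Real.log n⌉₊ : ℝ) ≤ D * Real.log n + 1 :=
      (Nat.ceil_lt_add_one (by positivity)).le
    have h3 : Real.log n ≤ 2 * σ / t * (n * r n ^ d) := by
      rw [le_div_iff₀ hL] at hl
      rw [div_mul_eq_mul_div, le_div_iff₀ ht]
      linarith
    have h4 : 0 ≤ (n : ℝ) * r n ^ d := mul_nonneg (Nat.cast_nonneg n) (pow_nonneg (hr n).le d)
    calc (NoisyRGG.edgeCliqueNumber (NoisyRGG.noisyGraph N r X ξ n ω) u v : ℝ)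
        ≤ 2 * (⌈D * Real.log n⌉₊ : ℝ) := by exact_mod_cast h1
      _ ≤ (2 * D + 2) * Real.log n := by linarith
      _ ≤ (2 * D + 2) * (2 * σ / t * (n * r n ^ d)) := by gcongr
      _ ≤ _ := by linarith
  · filter_upwards [hlog1, hup] with n hn hu
    have hL : 0 < Real.log n := by linarith
    have hrn : 0 ≤ r n ^ d := pow_nonneg (hr n).le d
    have hp0 : 0 ≤ σ * (r n ^ d * c) := by positivity
    refine (NoisyRGG.prob_exists_isClique_le N hS r hp0 n _ (fun x => ?_) (hqC n)).trans
      (ENNReal.ofReal_le_ofReal (NoisyRGG.clique_bound_le_two_div hp0 hn hB ?_ (Nat.le_ceil _)))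
    · refine (NoisyRGG.withDensity_closedBall_le N f x (hr n)).trans_eq ?_
      rw [ENNReal.ofReal_mul hσ0, ENNReal.ofReal_mul hrn, ENNReal.ofReal_toReal hσ,
        ENNReal.ofReal_toReal (NoisyRGG.volume_closedBall_one_ne_top N hN)]
    · rw [div_le_iff₀ hL] at hu
      calc (n : ℝ) * (σ * (r n ^ d * c)) = c * (σ * n * r n ^ d) := by ring
        _ ≤ c * (2 * t * Real.log n) := by gcongr
        _ = _ := by rw [hBdef]; ring
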